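/- Let $G$ be a finite group with identity element $e$, and let $D(G)$ be its Drinfeld double over $\mathbb C$: the Hopf algebra with basis $\delta_a\otimes x$ ($a,x\in G$), product $(\delta_a\otimes x)(\delta_b\otimes y)=\delta_{a,\,xbx^{-1}}\,\delta_a\otimes xy$, coproduct $\Delta(\delta_a\otimes x)=\sum_{bc=a}(\delta_b\otimes x)\otimes(\delta_c\otimes x)$, counit $\varepsilon(\delta_a\otimes x)=\delta_{a,e}$ and antipode $S(\delta_a\otimes x)=\delta_{x^{-1}a^{-1}x}\otimes x^{-1}$. Let $\Lambda$ be its normalized two-sided integral, i.e. the element with $h\Lambda=\varepsilon(h)\Lambda=\Lambda h$ for all $h\in D(G)$ and $\varepsilon(\Lambda)=1$. For an integer $m$, the $m$-th Frobenius–Schur indicator of a finite-dimensional $D(G)$-module $V$ with character $\chi_V$ is $\nu_m(V)=\chi_V(\Lambda^{[m]})$, where $h\mapsto h^{[m]}$ is the $m$-th convolution power of the identity map of $D(G)$; thus $\Lambda^{[m]}=\Lambda_{(1)}\Lambda_{(2)}\cdots\Lambda_{(m)}$ for $m\ge 1$. For $x\in G$ write $C_G(x)$ for its centralizer. For $g\in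 G$ and a complex character $\eta$ of $C_G(g)$, afforded by a finite-dimensional representation $W$, let $\nu_m(g,\eta)$ be the $m$-th indicator of the associated $D(G)$-module: the representation of $G$ induced from $W$, graded by the conjugacy class of $g$ in such a way that the component of degree $g$ is $W$, where $\delta_a$ acts as the projection onto the component of degree $a$. For $m\in\mathbb Z$ and $z\in G$, define functions on $C_G(z)$ by $$\gamma_m^z(g)=\bigl|\{x\in G : x^m=(gx)^m=z\}\bigr|,\qquad w_m^z(x)=\delta_{x^m,z}.$$ Then, for every $m\in\mathbb Z$, every $g\in G$ and every character $\eta$ of $C_G(g)$, and for every set $R$ of representatives of the conjugacy classes of $C_G(g)$, $$\nu_m(g,\eta)=\frac1{|C_G(g)|}\sum_{z\in C_G(g)}\gamma_m^z(g)\,\eta(z)=\frac1{|C_G(g)|}\sum_{z\in R}\bigl|z^{C_G(g)}\bigr|\,\gamma_m^z(g)\,\eta(z),$$ where $z^{C_G(g)}$ is the conjugacy class of $z$ in $C_G(g)$; and, for every $z\in G$, $$\gamma_m^z=|C_G(z)|\sum_{\chi\in\mathrm{Irr}(C_G(z))}\frac{|\langle\chi,w_m^z\rangle|^2}{\chi(e)}\,\chi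 ,$$ where $\mathrm{Irr}(C_G(z))$ is the set of irreducible complex characters of $C_G(z)$ and $\langle\chi,\psi\rangle=\frac1{|C_G(z)|}\sum_{x\in C_G(z)}\chi(x)\overline{\psi(x)}$. -/

import Mathlib

open scoped TensorProduct

noncomputable section

/-! ### The Drinfeld double of a finite group -/

/-- The underlying space of the Drinfeld double `D(G)` of a finite group: the complex vector space
with basis `δ_a ⊗ x`, for `a, x ∈ G`. An element is given by its coefficients in this basis. -/
def DrinfeldDouble (G : Type*) : Type _ := G × G → ℂ

namespace DrinfeldDouble

variable {G : Type*}

instance : AddCommGroup (DrinfeldDouble G) := inferInstanceAs (AddCommGroup (G × G → ℂ))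

instance : Module ℂ (DrinfeldDouble G) := inferInstanceAs (Module ℂ (G × G → ℂ))

@[ext]
theorem ext' {f h : DrinfeldDouble G} (H : ∀ p, f p = h p) : f = h := funext H

@[simp] theorem add_apply (f h : DrinfeldDouble G) (p : G × G) : (f + h) p = f p + h p := rfl

@[simp] theorem zero_apply (p : G × G) : (0 : DrinfeldDouble G) p = 0 := rfl

@[simp] theorem smul_apply (c : ℂ) (f : DrinfeldDouble G) (p : G × G) : (c • f) p = c * f p := rfl

@[simp] theorem sum_apply {ι : Type*} (s : Finset ι) (F : ι → DrinfeldDouble G) (p : G × G) :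
    (∑ i ∈ s, F i) p = ∑ i ∈ s, F i p :=
  Finset.sum_apply (M := fun _ => ℂ) p s F

section Basis

variable [DecidableEq G]

/-- The basis element `δ_a ⊗ x` of `D(G)`. -/
def e (a x : G) : DrinfeldDouble G := Pi.single (a, x) (1 : ℂ)

theorem e_apply (a x : G) (p : G × G) : e a x p = if p = (a, x) then 1 else 0 := by
  simp [e, Pi.single_apply]

variable [Fintype G]

theorem eq_sum_e (f : DrinfeldDouble G) : f = ∑ p : G × G, f p • e p.1 p.2 := by
  ext p
  rw [sum_apply, Finset.sum_eq_single p]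
  · simp [e_apply]
  · intro q _ hq; simp [e_apply, hq.symm]
  · simp

theorem linearMap_ext {M : Type*} [AddCommMonoid M] [Module ℂ M]
    {S T : DrinfeldDouble G →ₗ[ℂ] M} (h : ∀ a x, S (e a x) = T (e a x)) : S = T := by
  refine LinearMap.ext fun f => ?_
  rw [eq_sum_e f]
  simp [h]

end Basis

variable [Group G] [Fintype G]

/-- The product of `D(G)`, with `(δ_a ⊗ x) (δ_b ⊗ y) = δ_a δ_{x b x⁻¹} ⊗ x y`. -/
instance : Mul (DrinfeldDouble G) where
  mul f h := fun p => ∑ y : G, f (p.1, y) * h (y⁻¹ * p.1 * y, y⁻¹ * p.2)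

theorem mul_apply (f h : DrinfeldDouble G) (p : G × G) :
    (f * h) p = ∑ y : G, f (p.1, y) * h (y⁻¹ * p.1 * y, y⁻¹ * p.2) := rfl

variable [DecidableEq G]

set_option linter.unusedSectionVars false

/-- The unit of `D(G)` is `∑_a δ_a ⊗ e`. -/
instance : One (DrinfeldDouble G) where
  one := fun p => if p.2 = 1 then 1 else 0

theorem one_apply (p : G × G) : (1 : DrinfeldDouble G) p = if p.2 = 1 then 1 else 0 := rfl

theorem one_eq_sum : (1 : DrinfeldDouble G) = ∑ a : G, e a 1 := by
  ext ⟨a, x⟩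
  by_cases hx : x = 1 <;> simp [one_apply, e_apply, hx]

instance : Ring (DrinfeldDouble G) where
  __ := (inferInstance : AddCommGroup (DrinfeldDouble G))
  left_distrib f h k := by ext p; simp [mul_apply, mul_add, Finset.sum_add_distrib]
  right_distrib f h k := by ext p; simp [mul_apply, add_mul, Finset.sum_add_distrib]
  zero_mul f := by ext p; simp [mul_apply]
  mul_zero f := by ext p; simp [mul_apply]
  mul_assoc f h k := by
    ext ⟨a, x⟩
    simp only [mul_apply, Finset.sum_mul, Finset.mul_sum]
    rw [Finset.sum_comm]
    refine Finset.sum_congr rfl fun y _ => ?_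
    refine Fintype.sum_equiv (Equiv.mulLeft y⁻¹) _ _ fun z => ?_
    simp [mul_assoc]
  one_mul f := by ext ⟨a, x⟩; simp [mul_apply, one_apply]
  mul_one f := by
    ext ⟨a, x⟩
    simp [mul_apply, one_apply, inv_mul_eq_one]

instance : Algebra ℂ (DrinfeldDouble G) :=
  Algebra.ofModule
    (fun c f h => by ext p; simp [mul_apply, Finset.mul_sum, mul_assoc])
    (fun c f h => by ext p; simp [mul_apply, Finset.mul_sum, mul_left_comm])

theorem e_mul_e (a x b y : G) :
    e a x * e b y = if a = x * b * x⁻¹ then e a (x * y) else 0 := by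
  ext ⟨c, z⟩
  have h1 : (a = x * b * x⁻¹) ↔ (x⁻¹ * a * x = b) := by
    constructor
    · rintro rfl; group
    · rintro rfl; group
  have h2 : (x⁻¹ * z = y) ↔ (z = x * y) := inv_mul_eq_iff_eq_mul
  rw [mul_apply, Finset.sum_eq_single x]
  · by_cases hc : c = a
    · subst hc
      by_cases h : c = x * b * x⁻¹
      · rw [if_pos h]
        simp [e_apply, h1.1 h, h2]
      · rw [if_neg h]
        simp [e_apply, mt h1.2 h]
    · split_ifs <;> simp [e_apply, hc]
  · intro w _ hw
    simp [e_apply, hw]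
  · simp

/-- The comultiplication of `D(G)`: `Δ(δ_a ⊗ x) = ∑_{b c = a} (δ_b ⊗ x) ⊗ (δ_c ⊗ x)`. -/
def comulMap : DrinfeldDouble G →ₗ[ℂ] DrinfeldDouble G ⊗[ℂ] DrinfeldDouble G where
  toFun f := ∑ b : G, ∑ c : G, ∑ x : G, f (b * c, x) • (e b x ⊗ₜ[ℂ] e c x)
  map_add' f h := by simp [add_smul, Finset.sum_add_distrib]
  map_smul' r f := by simp [mul_smul, Finset.smul_sum]

theorem comulMap_e (a x : G) :
    comulMap (e a x) = ∑ b : G, e b x ⊗ₜ[ℂ] e (b⁻¹ * a) x := by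
  change ∑ b : G, ∑ c : G, ∑ y : G, e a x (b * c, y) • (e b y ⊗ₜ[ℂ] e c y) = _
  refine Finset.sum_congr rfl fun b _ => ?_
  rw [Finset.sum_eq_single (b⁻¹ * a), Finset.sum_eq_single x]
  · simp [e_apply]
  · intro y _ hy; simp [e_apply, hy]
  · simp
  · intro c _ hc
    have : b * c ≠ a := fun h => hc (by rw [← h]; group)
    simp [e_apply, this]
  · simp

/-- The counit of `D(G)`: `ε(δ_a ⊗ x) = δ_{a, e}`. -/
def counitMap : DrinfeldDouble G →ₗ[ℂ] ℂ where
  toFun f := ∑ x : G, f (1, x)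
  map_add' f h := by simp [Finset.sum_add_distrib]
  map_smul' r f := by simp [Finset.mul_sum]

theorem counitMap_e (a x : G) : counitMap (e a x) = if a = 1 then 1 else 0 := by
  change ∑ y : G, e a x (1, y) = _
  by_cases h : a = 1
  · subst h; simp [e_apply]
  · simp [e_apply, h, Ne.symm h]

/-- The antipode of `D(G)`: `S(δ_a ⊗ x) = δ_{x⁻¹ a⁻¹ x} ⊗ x⁻¹`. -/
def antipodeMap : DrinfeldDouble G →ₗ[ℂ] DrinfeldDouble G where
  toFun f := fun p => f (p.2⁻¹ * p.1⁻¹ * p.2, p.2⁻¹)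
  map_add' _ _ := rfl
  map_smul' _ _ := rfl

theorem antipodeMap_e (a x : G) : antipodeMap (e a x) = e (x⁻¹ * a⁻¹ * x) x⁻¹ := by
  ext ⟨c, z⟩
  change e a x (z⁻¹ * c⁻¹ * z, z⁻¹) = _
  simp only [e_apply, Prod.mk.injEq]
  congr 1
  apply propext
  constructor
  · rintro ⟨rfl, rfl⟩; exact ⟨by group, by group⟩
  · rintro ⟨rfl, rfl⟩; exact ⟨by group, by group⟩

instance : Coalgebra ℂ (DrinfeldDouble G) where
  comul := comulMap
  counit := counitMap
  coassoc := by
    refine linearMap_ext fun a x => ?_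
    simp only [LinearMap.comp_apply, comulMap_e, map_sum, LinearMap.rTensor_tmul,
      LinearMap.lTensor_tmul, TensorProduct.sum_tmul, TensorProduct.tmul_sum,
      LinearEquiv.coe_coe, TensorProduct.assoc_tmul]
    rw [Finset.sum_comm]
    refine Finset.sum_congr rfl fun b _ => ?_
    refine Fintype.sum_equiv (Equiv.mulLeft b⁻¹) _ _ fun c => ?_
    simp [mul_assoc]
  rTensor_counit_comp_comul := by
    refine linearMap_ext fun a x => ?_
    simp only [LinearMap.comp_apply, comulMap_e, map_sum, LinearMap.rTensor_tmul, counitMap_e]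
    rw [Finset.sum_eq_single 1]
    · simp
    · intro b _ hb; simp [hb]
    · simp
  lTensor_counit_comp_comul := by
    refine linearMap_ext fun a x => ?_
    simp only [LinearMap.comp_apply, comulMap_e, map_sum, LinearMap.lTensor_tmul, counitMap_e]
    rw [Finset.sum_eq_single a]
    · simp
    · intro b _ hb
      have : b⁻¹ * a ≠ 1 := fun h => hb (inv_mul_eq_one.1 h)
      simp [this]
    · simp

theorem comul_e (a x : G) :
    Coalgebra.comul (R := ℂ) (e a x) = ∑ b : G, e b x ⊗ₜ[ℂ] e (b⁻¹ * a) x := comulMap_e a x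

theorem counit_e (a x : G) :
    Coalgebra.counit (R := ℂ) (e a x) = if a = 1 then (1 : ℂ) else 0 := counitMap_e a x

theorem counit_mul' (f h : DrinfeldDouble G) :
    counitMap (f * h) = counitMap f * counitMap h := by
  have : (LinearMap.mul ℂ (DrinfeldDouble G)).compr₂ counitMap =
      (LinearMap.mul ℂ ℂ).compl₁₂ counitMap counitMap := by
    refine linearMap_ext fun a x => linearMap_ext fun b y => ?_
    simp only [LinearMap.compr₂_apply, LinearMap.compl₁₂_apply, LinearMap.mul_apply', e_mul_e,
      counitMap_e]
    by_cases ha : a = 1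
    · subst ha
      have : (1 = x * b * x⁻¹) ↔ b = 1 := by
        rw [eq_comm, mul_inv_eq_one, mul_eq_left]
      by_cases hb : b = 1
      · subst hb; simp [counitMap_e]
      · simp [this, hb]
    · split_ifs <;> simp [counitMap_e, ha]
  exact LinearMap.congr_fun₂ this f h

theorem comul_mul' (f h : DrinfeldDouble G) :
    comulMap (f * h) = comulMap f * comulMap h := by
  have : (LinearMap.mul ℂ (DrinfeldDouble G)).compr₂ comulMap =
      (LinearMap.mul ℂ (DrinfeldDouble G ⊗[ℂ] DrinfeldDouble G)).compl₁₂ comulMap comulMap := by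
    refine linearMap_ext fun a x => linearMap_ext fun b y => ?_
    simp only [LinearMap.compr₂_apply, LinearMap.compl₁₂_apply, LinearMap.mul_apply', e_mul_e,
      comulMap_e, Finset.sum_mul, Finset.mul_sum, Algebra.TensorProduct.tmul_mul_tmul]
    have key : ∀ c : G, ∑ d : G, ((if c = x * d * x⁻¹ then e c (x * y) else 0) ⊗ₜ[ℂ]
        (if c⁻¹ * a = x * (d⁻¹ * b) * x⁻¹ then e (c⁻¹ * a) (x * y) else 0)) =
        if a = x * b * x⁻¹ then e c (x * y) ⊗ₜ[ℂ] e (c⁻¹ * a) (x * y) else 0 := by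
      intro c
      rw [Finset.sum_eq_single (x⁻¹ * c * x)]
      · have h1 : c = x * (x⁻¹ * c * x) * x⁻¹ := by group
        have h2 : (c⁻¹ * a = x * ((x⁻¹ * c * x)⁻¹ * b) * x⁻¹) ↔ a = x * b * x⁻¹ := by
          have : x * ((x⁻¹ * c * x)⁻¹ * b) * x⁻¹ = c⁻¹ * (x * b * x⁻¹) := by group
          rw [this, mul_right_inj]
        rw [if_pos h1]
        by_cases h : a = x * b * x⁻¹
        · rw [if_pos (h2.2 h), if_pos h]
        · rw [if_neg (mt h2.1 h), if_neg h, TensorProduct.tmul_zero]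
      · intro d _ hd
        have : c ≠ x * d * x⁻¹ := by rintro rfl; exact hd (by group)
        rw [if_neg this, TensorProduct.zero_tmul]
      · simp
    rw [Finset.sum_comm]
    simp only [key]
    split_ifs <;> simp [comulMap_e]
  exact LinearMap.congr_fun₂ this f h

instance : Bialgebra ℂ (DrinfeldDouble G) :=
  Bialgebra.mk' ℂ (DrinfeldDouble G)
    (by
      change counitMap (1 : DrinfeldDouble G) = 1
      simp [one_eq_sum, counitMap_e])
    (fun {f h} => counit_mul' f h)
    (by
      change comulMap (1 : DrinfeldDouble G) = 1
      simp only [Algebra.TensorProduct.one_def, one_eq_sum, map_sum, comulMap_e,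
        TensorProduct.sum_tmul, TensorProduct.tmul_sum]
      rw [Finset.sum_comm]
      conv_rhs => rw [Finset.sum_comm]
      refine Finset.sum_congr rfl fun b _ => ?_
      exact Fintype.sum_equiv (Equiv.mulLeft b⁻¹) _ _ fun c => rfl)
    (fun {f h} => comul_mul' f h)

instance : HopfAlgebra ℂ (DrinfeldDouble G) where
  antipode := antipodeMap
  mul_antipode_rTensor_comul := by
    refine linearMap_ext fun a x => ?_
    simp only [LinearMap.comp_apply, comul_e, counit_e, map_sum, LinearMap.rTensor_tmul,
      antipodeMap_e, LinearMap.mul'_apply, e_mul_e]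
    by_cases ha : a = 1
    · subst ha
      have : ∀ b : G, (x⁻¹ * b⁻¹ * x = x⁻¹ * (b⁻¹ * 1) * x⁻¹⁻¹) := fun b => by group
      simp only [this, if_true, inv_mul_cancel, Algebra.linearMap_apply, map_one, one_eq_sum]
      exact Fintype.sum_equiv ((Equiv.inv G).trans (MulAut.conj x⁻¹).toEquiv) _ _
        fun c => by simp
    · have : ∀ b : G, ¬ (x⁻¹ * b⁻¹ * x = x⁻¹ * (b⁻¹ * a) * x⁻¹⁻¹) := fun b h => ha (by
        simpa [mul_assoc] using h.symm)
      simp only [this, ha, if_false, Finset.sum_const_zero, map_zero]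
  mul_antipode_lTensor_comul := by
    refine linearMap_ext fun a x => ?_
    simp only [LinearMap.comp_apply, comul_e, counit_e, map_sum, LinearMap.lTensor_tmul,
      antipodeMap_e, LinearMap.mul'_apply, e_mul_e]
    have h : ∀ b : G, (b = x * (x⁻¹ * (b⁻¹ * a)⁻¹ * x) * x⁻¹) ↔ a = 1 := fun b => by
      have : x * (x⁻¹ * (b⁻¹ * a)⁻¹ * x) * x⁻¹ = a⁻¹ * b := by group
      rw [this, eq_comm, mul_eq_right, inv_eq_one]
    by_cases ha : a = 1
    · simp only [h, if_pos ha, mul_inv_cancel, Algebra.linearMap_apply, map_one, one_eq_sum]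
    · simp only [h, ha, if_false, Finset.sum_const_zero, map_zero]

end DrinfeldDouble

/-! ### Higher Frobenius–Schur indicators of modules over a Hopf algebra -/

section Indicator

variable (H : Type*) [Ring H] [HopfAlgebra ℂ H]

/-- `Λ` is a normalized two-sided integral of the Hopf algebra `H`: `h Λ = ε(h) Λ = Λ h` for all
`h ∈ H`, and `ε(Λ) = 1`. -/
structure IsNormalizedIntegral (Λ : H) : Prop where
  mul_left : ∀ h : H, h * Λ = Coalgebra.counit (R := ℂ) h • Λ
  mul_right : ∀ h : H, Λ * h = Coalgebra.counit (R := ℂ) h • Λ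
  counit_eq_one : Coalgebra.counit (R := ℂ) Λ = 1

variable {H}

theorem IsNormalizedIntegral.unique {Λ Λ' : H} (h : IsNormalizedIntegral H Λ)
    (h' : IsNormalizedIntegral H Λ') : Λ = Λ' := by
  have h1 := h.mul_right Λ'
  have h2 := h'.mul_left Λ
  rw [h'.counit_eq_one, one_smul] at h1
  rw [h.counit_eq_one, one_smul] at h2
  exact h1.symm.trans h2

variable (H) in
open Classical in
/-- The normalized two-sided integral of `H`. It is unique if it exists, and it exists when `H` is
finite-dimensional and semisimple; the value is `0` if it does not exist. -/
def normalizedIntegral : H :=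
  if h : ∃ Λ : H, IsNormalizedIntegral H Λ then h.choose else 0

theorem IsNormalizedIntegral.normalizedIntegral_eq {Λ : H} (h : IsNormalizedIntegral H Λ) :
    normalizedIntegral H = Λ := by
  have hex : ∃ Λ : H, IsNormalizedIntegral H Λ := ⟨Λ, h⟩
  rw [normalizedIntegral, dif_pos hex]
  exact hex.choose_spec.unique h

/-- The `m`-th Sweedler power map `h ↦ h_(1) h_(2) ⋯ h_(m)`, i.e. the `m`-th power of the identity
with respect to the convolution product on linear endomorphisms of `H`. For `m = 0` this is
`h ↦ ε(h) 1`, and for negative `m` it is the `|m|`-th convolution power of the antipode, which is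
the convolution inverse of the identity. -/
def sweedlerPower : ℤ → H →ₗ[ℂ] H
  | Int.ofNat n => ((WithConv.toConv (LinearMap.id : H →ₗ[ℂ] H)) ^ n).ofConv
  | Int.negSucc n => ((WithConv.toConv (HopfAlgebra.antipode ℂ : H →ₗ[ℂ] H)) ^ (n + 1)).ofConv

/-- The `m`-th Frobenius–Schur indicator `ν_m(V) = χ_V(Λ_(1) Λ_(2) ⋯ Λ_(m))` of a module `V` over
`H`, given by its structure map `ρ`; here `Λ` is the normalized integral of `H`, and `χ_V` is the
character of `V`. -/
def fsIndicator {V : Type*} [AddCommGroup V] [Module ℂ V] (ρ : H →ₐ[ℂ] Module.End ℂ V) (m : ℤ) :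
    ℂ :=
  LinearMap.trace ℂ V (ρ (sweedlerPower m (normalizedIntegral H)))

end Indicator

namespace DrinfeldDouble

variable {G : Type*} [Group G] [Fintype G] [DecidableEq G]

/-- The element `|G|⁻¹ ∑_x δ_e ⊗ x` is the normalized integral of `D(G)`. -/
theorem isNormalizedIntegral :
    IsNormalizedIntegral (DrinfeldDouble G) ((Fintype.card G : ℂ)⁻¹ • ∑ x : G, e 1 x) where
  mul_left h := by
    have : (LinearMap.mul ℂ (DrinfeldDouble G)).flip
        ((Fintype.card G : ℂ)⁻¹ • ∑ x : G, e (1 : G) x) =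
        (Coalgebra.counit (R := ℂ)).smulRight ((Fintype.card G : ℂ)⁻¹ • ∑ x : G, e (1 : G) x) := by
      refine linearMap_ext fun a y => ?_
      simp only [LinearMap.flip_apply, LinearMap.mul_apply', LinearMap.smulRight_apply, counit_e,
        mul_smul_comm, Finset.mul_sum, e_mul_e, mul_one, mul_inv_cancel]
      by_cases ha : a = 1
      · subst ha
        simp only [if_true, one_smul]
        congr 1
        exact Fintype.sum_equiv (Equiv.mulLeft y) _ _ fun c => rfl
      · simp [ha]
    exact LinearMap.congr_fun this h
  mul_right h := by
    have : LinearMap.mul ℂ (DrinfeldDouble G) ((Fintype.card G : ℂ)⁻¹ • ∑ x : G, e (1 : G) x) =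
        (Coalgebra.counit (R := ℂ)).smulRight ((Fintype.card G : ℂ)⁻¹ • ∑ x : G, e (1 : G) x) := by
      refine linearMap_ext fun a y => ?_
      have h1 : ∀ x : G, (1 = x * a * x⁻¹) ↔ a = 1 := fun x => by
        rw [eq_comm, mul_inv_eq_one, mul_eq_left]
      simp only [LinearMap.mul_apply', LinearMap.smulRight_apply, counit_e,
        smul_mul_assoc, Finset.sum_mul, e_mul_e, h1]
      by_cases ha : a = 1
      · subst ha
        simp only [if_true, one_smul]
        congr 1
        exact Fintype.sum_equiv (Equiv.mulRight y) _ _ fun c => rfl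
      · simp [ha]
    exact LinearMap.congr_fun this h
  counit_eq_one := by
    simp [counit_e]

theorem normalizedIntegral_eq :
    normalizedIntegral (DrinfeldDouble G) = (Fintype.card G : ℂ)⁻¹ • ∑ x : G, e 1 x :=
  isNormalizedIntegral.normalizedIntegral_eq

/-- The `D(G)`-module associated with `g ∈ G` and a representation `σ` of the centralizer
`C = C_G(g)` on `W`. Its space consists of the functions `v : G → W` with `v (c t) = σ(c) (v t)` for
`c ∈ C`, i.e. the representation of `G` (co)induced from `σ`, on which `x ∈ G` acts by
`(x v)(t) = v (t x)`; moreover `δ_a` acts as the projection onto the functions supported on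
`{t | t⁻¹ g t = a}`. Thus the component of degree `g` is the representation `σ` of `C`, and the
components of the degrees not conjugate to `g` vanish. -/
def moduleOf (g : G) {W : Type*} [AddCommGroup W] [Module ℂ W]
    (σ : Representation ℂ (Subgroup.centralizer {g}) W) :
    DrinfeldDouble G →ₐ[ℂ]
      Module.End ℂ (Representation.coindV (Subgroup.centralizer {g}).subtype σ) :=
  AlgHom.ofLinearMap
    { toFun := fun f =>
        { toFun := fun v =>
            ⟨fun t => ∑ x : G, f (t⁻¹ * g * t, x) • (v : G → W) (t * x), by
              intro c t
              have hc : (c : G)⁻¹ * g * c = g := by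
                have := Subgroup.mem_centralizer_singleton_iff.1 c.2
                rw [mul_assoc, ← this]; group
              have h1 : ((c : G) * t)⁻¹ * g * (c * t) = t⁻¹ * g * t := by
                rw [mul_inv_rev]
                calc t⁻¹ * (c : G)⁻¹ * g * (c * t) = t⁻¹ * ((c : G)⁻¹ * g * c) * t := by group
                  _ = _ := by rw [hc]
              have h2 : ∀ x : G, (v : G → W) ((c : G) * t * x) = σ c ((v : G → W) (t * x)) :=
                fun x => by rw [mul_assoc]; exact v.2 c (t * x)
              simp only [Subgroup.coe_subtype, h1, h2, map_sum, map_smul]⟩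
          map_add' := fun v w => by
            ext t
            simp [Finset.sum_add_distrib]
          map_smul' := fun r v => by
            ext t
            simp [Finset.smul_sum, smul_comm r] }
      map_add' := fun f h => by
        ext v t
        simp [add_smul, Finset.sum_add_distrib]
      map_smul' := fun r f => by
        ext v t
        simp [mul_smul, Finset.smul_sum] }
    (by
      ext v t
      simp [one_apply])
    (by
      intro f h
      ext v t
      simp only [LinearMap.coe_mk, AddHom.coe_mk, Module.End.mul_apply, mul_apply,
        Finset.sum_smul, Finset.smul_sum, mul_smul]
      rw [Finset.sum_comm]
      refine Finset.sum_congr rfl fun y _ => ?_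
      refine Fintype.sum_equiv (Equiv.mulLeft y⁻¹) _ _ fun z => ?_
      simp [mul_assoc])

theorem moduleOf_apply (g : G) {W : Type*} [AddCommGroup W] [Module ℂ W]
    (σ : Representation ℂ (Subgroup.centralizer {g}) W) (f : DrinfeldDouble G)
    (v : Representation.coindV (Subgroup.centralizer {g}).subtype σ) (t : G) :
    (moduleOf g σ f v : G → W) t = ∑ x : G, f (t⁻¹ * g * t, x) • (v : G → W) (t * x) := rfl

end DrinfeldDouble

/-! ### Characters and class functions -/

/-- The set of irreducible complex characters of a group. -/
def irrChars (K : Type*) [Group K] : Set (K → ℂ) :=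
  {χ | ∃ (n : ℕ) (ρ : Representation ℂ K (Fin n → ℂ)), ρ.IsIrreducible ∧ ρ.character = χ}

theorem irrChars_finite (K : Type*) [Group K] [Finite K] : (irrChars K).Finite := by
  classical
  have := Fintype.ofFinite K
  have hK : (Nat.card K : ℂ) ≠ 0 := Nat.cast_ne_zero.2 Nat.card_pos.ne'
  let _ : Invertible (Nat.card K : ℂ) := invertibleOfNonzero hK
  have key : ∀ χ ∈ irrChars K, ∀ ψ ∈ irrChars K,
      (Nat.card K : ℂ)⁻¹ * ∑ x : K, χ x * ψ x⁻¹ = if χ = ψ then 1 else 0 := by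
    rintro χ ⟨n, ρ, hρ, rfl⟩ ψ ⟨k, τ, hτ, rfl⟩
    have h := Representation.char_orthonormal ρ τ
    by_cases hne : Nonempty (Representation.Equiv τ ρ)
    · rw [if_pos hne] at h
      rw [h, if_pos (Representation.char_iso hne.some).symm]
    · rw [if_neg hne] at h
      rw [h, if_neg]
      intro heq
      have h' := Representation.char_orthonormal ρ ρ
      rw [if_pos ⟨Representation.Equiv.refl ρ⟩] at h'
      rw [← heq, h'] at h
      exact one_ne_zero h
  have hli : LinearIndependent ℂ (fun χ : irrChars K => (χ : K → ℂ)) := by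
    rw [linearIndependent_iff']
    intro s c hc ψ hψ
    have h0 : ∀ x, ∑ χ ∈ s, c χ * (χ : K → ℂ) x = 0 := fun x => by
      have := congrFun hc x
      simpa using this
    have h1 : (Nat.card K : ℂ)⁻¹ * ∑ x : K, (∑ χ ∈ s, c χ * (χ : K → ℂ) x) * (ψ : K → ℂ) x⁻¹ = 0 := by
      simp [h0]
    have h2 : (Nat.card K : ℂ)⁻¹ * ∑ x : K, (∑ χ ∈ s, c χ * (χ : K → ℂ) x) * (ψ : K → ℂ) x⁻¹ =
        ∑ χ ∈ s, c χ * ((Nat.card K : ℂ)⁻¹ * ∑ x : K, (χ : K → ℂ) x * (ψ : K → ℂ) x⁻¹) := by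
      simp only [Finset.sum_mul, Finset.mul_sum]
      rw [Finset.sum_comm]
      refine Finset.sum_congr rfl fun χ _ => Finset.sum_congr rfl fun x _ => ?_
      ring
    rw [h1] at h2
    have h3 : ∑ χ ∈ s, c χ * ((Nat.card K : ℂ)⁻¹ * ∑ x : K, (χ : K → ℂ) x * (ψ : K → ℂ) x⁻¹) =
        c ψ := by
      rw [Finset.sum_eq_single ψ]
      · rw [key _ ψ.2 _ ψ.2, if_pos rfl, mul_one]
      · intro χ _ hne
        rw [key _ χ.2 _ ψ.2, if_neg (fun h => hne (Subtype.ext h)), mul_zero]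
      · exact fun h => absurd hψ h
    rw [← h3, ← h2]
  exact hli.setFinite

/-- The (finite) set of irreducible complex characters of a finite group. -/
def Irr (K : Type*) [Group K] [Finite K] : Finset (K → ℂ) := (irrChars_finite K).toFinset

/-- The inner product `⟨χ, ψ⟩ = |K|⁻¹ ∑_x χ(x) conj(ψ(x))` of class functions. -/
def charInner {K : Type*} [Fintype K] (χ ψ : K → ℂ) : ℂ :=
  (Fintype.card K : ℂ)⁻¹ * ∑ x : K, χ x * (starRingEnd ℂ) (ψ x)

section Counting

variable {G : Type*} [Group G]

/-- The class function `w_m^z` on `C_G(z)`: `w_m^z(x) = 1` if `x ^ m = z`, and `0` otherwise. -/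
def rootIndicator [DecidableEq G] (m : ℤ) (z : G) (x : Subgroup.centralizer {z}) : ℂ :=
  if (x : G) ^ m = z then 1 else 0

/-- The function `γ_m^z` on `C_G(z)`: `γ_m^z(g)` is the cardinality of
`G_m(g, z) = {x ∈ G | x ^ m = (g x) ^ m = z}`. -/
def gammaFun (m : ℤ) (z : G) (g : Subgroup.centralizer {z}) : ℂ :=
  (Nat.card {x : G // x ^ m = z ∧ ((g : G) * x) ^ m = z} : ℂ)

theorem mem_centralizer_symm {g z : G} (h : z ∈ Subgroup.centralizer {g}) :
    g ∈ Subgroup.centralizer {z} :=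
  Subgroup.mem_centralizer_singleton_iff.2 (Subgroup.mem_centralizer_singleton_iff.1 h).symm

end Counting

end

/-! The indicator formula is a trace computation. In a product of m factors δ_{a_i} ⊗ x, the
multiplication rule forces a_i = x a_{i+1} x⁻¹, so everything is determined by the first degree b,
and a_1 ⋯ a_m telescopes to (b x⁻¹)^m x^m. Hence (δ_a ⊗ x)^{[m]} is the sum of δ_b ⊗ x^m over the b
with (b x⁻¹)^m x^m = a (`sweedlerPower_e`). Negative m follow the same pattern with the antipode.
Applied to Λ = |G|⁻¹ ∑ δ_e ⊗ x, this makes the coefficients of Λ^{[m]} counts of m-th roots.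

The trace on the coinduced space is computed on all functions G → W by composing with the averaging
projection; only the diagonal blocks matter (`trace_moduleOf`). A conjugation and a translation turn
each count into γ_m^z(g), independently of the block (`card_roots_eq`), so the sum over G cancels
|G|⁻¹.

For the character formula put K = C_G(z) and w = w_m^z. Every m-th root of z centralizes z, so
γ_m^z(g) = ∑_{x ∈ K} w(x) w(gx). The condition y = gx is detected by the regular character ∑ χ(e)
χ(g x y⁻¹). By Schur's lemma ∑ w(x) ρ(x) and ∑ w(y) ρ(y⁻¹) are scalars α and β for each irreducible
ρ, with αχ(e) = |K|⟨χ, w⟩ and βχ(e) its complex conjugate; αβ therefore yields |⟨χ, w⟩|²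
(`sum_sum_mul_irrChars`). -/

noncomputable section

/-! ### Traces by diagonal blocks -/

namespace LinearMap

/-- The trace of an endomorphism of `ι → W` is the sum of the traces of its diagonal blocks. -/
theorem trace_pi_eq_sum {k ι W : Type*} [Field k] [Fintype ι] [DecidableEq ι] [AddCommGroup W]
    [Module k W] [FiniteDimensional k W] (T : Module.End k (ι → W)) :
    trace k (ι → W) T =
      ∑ i, trace k W (proj i ∘ₗ T ∘ₗ single k (fun _ : ι => W) i) := by
  have h : T = ∑ i, (T ∘ₗ single k (fun _ : ι => W) i) ∘ₗ proj i := by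
    refine LinearMap.ext fun v => ?_
    have hv : v = ∑ i, single k (fun _ : ι => W) i (v i) := (Finset.univ_sum_single v).symm
    conv_lhs => rw [hv]
    simp [sum_apply]
  conv_lhs => rw [h]
  rw [map_sum]
  exact Finset.sum_congr rfl fun i _ => trace_comp_comm' _ _

end LinearMap

/-! ### Bijections between sets of roots -/

section Counting

variable {G : Type*} [Group G]

/-- Conjugation by `t` followed by right translation by `g⁻¹` identifies the two sets of roots. -/
theorem card_roots_eq (m : ℤ) (g t : G) (c : Subgroup.centralizer {g}) :
    (Nat.card {x : G // x ^ m = t⁻¹ * c * t ∧ (t⁻¹ * g * t * x⁻¹) ^ m * x ^ m = 1} : ℂ) =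
      gammaFun m (c : G) ⟨g, mem_centralizer_symm c.2⟩ := by
  rw [gammaFun]
  congr 1
  refine Nat.card_congr (Equiv.subtypeEquiv
    ((MulAut.conj t).toEquiv.trans (Equiv.mulLeft g⁻¹)) fun x => ?_)
  have hc : (c : G) * g = g * c := Subgroup.mem_centralizer_singleton_iff.1 c.2
  -- With y = t x t⁻¹ the new element is g⁻¹ y = g⁻¹ (y g⁻¹) g, and g times it is y. Since c
  -- commutes with g, its m-th power is c exactly when (y g⁻¹)^m = c.
  obtain ⟨y, rfl⟩ : ∃ y, x = t⁻¹ * y * t := ⟨t * x * t⁻¹, by group⟩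
  have h1 : ((MulAut.conj t).toEquiv.trans (Equiv.mulLeft g⁻¹)) (t⁻¹ * y * t) = g⁻¹ * y := by
    simp [mul_assoc]
  have h2 : t⁻¹ * g * t * (t⁻¹ * y * t)⁻¹ = t⁻¹ * (y * g⁻¹)⁻¹ * t⁻¹⁻¹ := by group
  have h3 : g⁻¹ * y = g⁻¹ * (y * g⁻¹) * g⁻¹⁻¹ := by group
  have h4 : t⁻¹ * y * t = t⁻¹ * y * t⁻¹⁻¹ := by group
  have h5 : ∀ z : G, t⁻¹ * z * t⁻¹⁻¹ = t⁻¹ * c * t ↔ z = c := fun z => by simp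
  rw [h1, h2, mul_inv_cancel_left, conj_zpow, h4, conj_zpow, h5, inv_zpow, h3, conj_zpow]
  have h6 : g⁻¹ * (y * g⁻¹) ^ m * g⁻¹⁻¹ = c ↔ (y * g⁻¹) ^ m = c := by
    rw [inv_inv, mul_assoc, inv_mul_eq_iff_eq_mul, ← hc, mul_left_inj]
  have h7 : t⁻¹ * ((y * g⁻¹) ^ m)⁻¹ * t⁻¹⁻¹ * (t⁻¹ * y ^ m * t⁻¹⁻¹) = 1 ↔
      (y * g⁻¹) ^ m = y ^ m := by
    have : t⁻¹ * ((y * g⁻¹) ^ m)⁻¹ * t⁻¹⁻¹ * (t⁻¹ * y ^ m * t⁻¹⁻¹) =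
        t⁻¹ * (((y * g⁻¹) ^ m)⁻¹ * y ^ m) * t⁻¹⁻¹ := by group
    rw [this, conj_eq_one_iff, inv_mul_eq_one]
  show _ ↔ g⁻¹ * (y * g⁻¹) ^ m * g⁻¹⁻¹ = c ∧ _
  rw [h6, h7]
  constructor
  · rintro ⟨h, h'⟩; exact ⟨h'.trans h, h⟩
  · rintro ⟨h, h'⟩; exact ⟨h', h.trans h'.symm⟩

/-- Conjugation by c fixes g and carries roots of z to roots of w. This makes the summand of the
indicator formula a class function of z on the centralizer of g. -/
theorem gammaFun_conj (m : ℤ) {g z w : G} (hz : g ∈ Subgroup.centralizer {z})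
    (hw : g ∈ Subgroup.centralizer {w}) (c : G) (hc : c ∈ Subgroup.centralizer {g})
    (h : c * z * c⁻¹ = w) : gammaFun m z ⟨g, hz⟩ = gammaFun m w ⟨g, hw⟩ := by
  rw [gammaFun, gammaFun]
  congr 1
  refine Nat.card_congr (Equiv.subtypeEquiv (MulAut.conj c).toEquiv fun x => ?_)
  have hc' : c * g = g * c := Subgroup.mem_centralizer_singleton_iff.1 hc
  have h1 : g * (c * x * c⁻¹) = c * (g * x) * c⁻¹ := by
    simp only [← mul_assoc, hc']
  simp only [MulEquiv.toEquiv_eq_coe, EquivLike.coe_coe, MulAut.conj_apply, h1, conj_zpow, ← h]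
  simp

end Counting

/-! ### The averaging projection onto the coinduced space -/

section CoindAverage

variable {G : Type*} [Group G] (g : G) {W : Type*} [AddCommGroup W] [Module ℂ W]
  (σ : Representation ℂ (Subgroup.centralizer {g}) W)

/-- Averaging over the centralizer of `g`, as a map from all functions `G → W` onto the space of
the module associated with `g` and `σ`. -/
def coindAverage [Fintype (Subgroup.centralizer {g})] :
    (G → W) →ₗ[ℂ] Representation.coindV (Subgroup.centralizer {g}).subtype σ :=
  LinearMap.codRestrict _
    (LinearMap.pi fun t => (Fintype.card (Subgroup.centralizer {g}) : ℂ)⁻¹ •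
      ∑ c : Subgroup.centralizer {g}, σ c ∘ₗ LinearMap.proj ((c : G)⁻¹ * t))
    (by
      intro v d t
      simp only [LinearMap.pi_apply, LinearMap.smul_apply, LinearMap.sum_apply,
        LinearMap.comp_apply, LinearMap.proj_apply, map_smul, map_sum]
      congr 1
      refine Fintype.sum_equiv (Equiv.mulLeft d⁻¹) _ _ fun c => ?_
      rw [← Module.End.mul_apply, ← map_mul]
      simp [mul_assoc])

theorem coindAverage_apply [Fintype (Subgroup.centralizer {g})] (v : G → W) (t : G) :
    (coindAverage g σ v : G → W) t = (Fintype.card (Subgroup.centralizer {g}) : ℂ)⁻¹ •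
      ∑ c : Subgroup.centralizer {g}, σ c (v ((c : G)⁻¹ * t)) := by
  change (LinearMap.pi _ : (G → W) →ₗ[ℂ] (G → W)) v t = _
  simp

/-- On an equivariant function each of the |C_G(g)| averaged terms already equals its value at t. -/
theorem coindAverage_subtype [Fintype (Subgroup.centralizer {g})] :
    coindAverage g σ ∘ₗ
      (Representation.coindV (Subgroup.centralizer {g}).subtype σ).subtype = LinearMap.id := by
  ext v t
  have h : ∀ c : Subgroup.centralizer {g}, σ c ((v : G → W) ((c : G)⁻¹ * t)) = (v : G → W) t := by
    intro c
    rw [← v.2 c ((c : G)⁻¹ * t)]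
    simp
  have hC : (Fintype.card (Subgroup.centralizer {g}) : ℂ) ≠ 0 :=
    Nat.cast_ne_zero.2 Fintype.card_ne_zero
  simp only [LinearMap.comp_apply, Submodule.subtype_apply, coindAverage_apply, h,
    Finset.sum_const, Finset.card_univ, LinearMap.id_apply]
  rw [← Nat.cast_smul_eq_nsmul ℂ, smul_smul, inv_mul_cancel₀ hC, one_smul]

end CoindAverage

/-! ### Sweedler powers in the Drinfeld double -/

namespace DrinfeldDouble

variable {G : Type*} [Group G] [Fintype G] [DecidableEq G]

theorem mul'_map_comul_e (S T : DrinfeldDouble G →ₗ[ℂ] DrinfeldDouble G) (a x : G) :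
    (WithConv.toConv S * WithConv.toConv T).ofConv (e a x) =
      ∑ b : G, S (e b x) * T (e (b⁻¹ * a) x) := by
  rw [LinearMap.convMul_def]
  simp [comul_e, map_sum]

/-- Only the degree c = x⁻¹ b x survives multiplication by δ_b ⊗ x, so the inner sum in each
convolution step collapses. -/
theorem sum_e_mul_sum_e (b x : G) (P : G → Prop) [DecidablePred P] (y : G) :
    e b x * ∑ c : G, (if P c then e c y else 0) =
      if P (x⁻¹ * b * x) then e b (x * y) else 0 := by
  rw [Finset.mul_sum, Finset.sum_eq_single (x⁻¹ * b * x)]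
  · have h : b = x * (x⁻¹ * b * x) * x⁻¹ := by group
    rw [mul_ite, mul_zero, e_mul_e, if_pos h]
  · intro c _ hc
    have h : b ≠ x * c * x⁻¹ := by
      rintro rfl
      exact hc (by group)
    rw [mul_ite, mul_zero, e_mul_e, if_neg h, ite_self]
  · simp

theorem one_ofConv_e (a x : G) :
    (1 : WithConv (DrinfeldDouble G →ₗ[ℂ] DrinfeldDouble G)).ofConv (e a x) =
      if a = 1 then ∑ b : G, e b 1 else 0 := by
  rw [LinearMap.convOne_def]
  simp only [LinearMap.comp_apply, counit_e, Algebra.linearMap_apply, ← one_eq_sum]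
  split_ifs <;> simp

/-- Peeling off the first factor δ_b ⊗ x leaves degree x⁻¹ b x for the rest, and b · x⁻¹ (b x⁻¹)^n x
· x^n = (b x⁻¹)^(n+1) x^(n+1). -/
theorem convPow_id_e (n : ℕ) (a x : G) :
    ((WithConv.toConv (LinearMap.id : DrinfeldDouble G →ₗ[ℂ] DrinfeldDouble G)) ^ n).ofConv
      (e a x) = ∑ b : G, if (b * x⁻¹) ^ n * x ^ n = a then e b (x ^ n) else 0 := by
  induction n generalizing a with
  | zero =>
    rw [pow_zero, one_ofConv_e]
    by_cases h : a = 1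
    · simp [h]
    · simp [h, Ne.symm h]
  | succ n ih =>
    rw [pow_succ', ← WithConv.toConv_ofConv (_ ^ n), mul'_map_comul_e]
    refine Finset.sum_congr rfl fun b _ => ?_
    rw [ih, LinearMap.id_apply, sum_e_mul_sum_e, ← pow_succ']
    refine if_congr ?_ rfl rfl
    rw [eq_inv_mul_iff_mul_eq]
    have h1 : x⁻¹ * b * x * x⁻¹ = x⁻¹ * (b * x⁻¹) * x⁻¹⁻¹ := by group
    have h2 : b * (x⁻¹ * (b * x⁻¹) ^ n * x⁻¹⁻¹ * x ^ n) =
        (b * x⁻¹) * (b * x⁻¹) ^ n * (x * x ^ n) := by group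
    rw [h1, conj_pow, h2, ← pow_succ', ← pow_succ']

theorem convPow_antipode_e (n : ℕ) (a x : G) :
    ((WithConv.toConv
      (HopfAlgebra.antipode ℂ : DrinfeldDouble G →ₗ[ℂ] DrinfeldDouble G)) ^ n).ofConv (e a x) =
      ∑ b : G, if (x * b⁻¹) ^ n * x⁻¹ ^ n = a then e b (x⁻¹ ^ n) else 0 := by
  induction n generalizing a with
  | zero =>
    rw [pow_zero, one_ofConv_e]
    by_cases h : a = 1
    · simp [h]
    · simp [h, Ne.symm h]
  | succ n ih =>
    rw [pow_succ', ← WithConv.toConv_ofConv (_ ^ n), mul'_map_comul_e]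
    -- The sum is reindexed by x⁻¹ b⁻¹ x, the degree of S(δ_b ⊗ x).
    refine Fintype.sum_equiv ((Equiv.inv G).trans (MulAut.conj x⁻¹).toEquiv) _ _ fun b => ?_
    have hS : HopfAlgebra.antipode ℂ (e b x) = e (x⁻¹ * b⁻¹ * x) x⁻¹ := antipodeMap_e b x
    have hb : ((Equiv.inv G).trans (MulAut.conj x⁻¹).toEquiv) b = x⁻¹ * b⁻¹ * x := by simp
    rw [ih, hS, hb, sum_e_mul_sum_e, ← pow_succ']
    refine if_congr ?_ rfl rfl
    rw [eq_inv_mul_iff_mul_eq]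
    have h1 : x * (x⁻¹⁻¹ * (x⁻¹ * b⁻¹ * x) * x⁻¹)⁻¹ = x * b := by group
    have h2 : x * (x⁻¹ * b⁻¹ * x)⁻¹ = b * x := by group
    rw [h1, h2, pow_succ (b * x), pow_succ' x⁻¹]
    have h3 : (b * x) ^ n * (b * x) * (x⁻¹ * x⁻¹ ^ n) = (b * x) ^ n * b * x⁻¹ ^ n := by group
    rw [h3, mul_pow_mul, mul_assoc]

/-- The two cases share one formula because (b x⁻¹)⁻¹ = x b⁻¹ is the base produced by powers of the
antipode. -/
theorem sweedlerPower_e (m : ℤ) (a x : G) :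
    sweedlerPower m (e a x) = ∑ b : G, if (b * x⁻¹) ^ m * x ^ m = a then e b (x ^ m) else 0 := by
  cases m with
  | ofNat n =>
    refine (convPow_id_e n a x).trans ?_
    simp
  | negSucc n =>
    have h : ∀ y : G, y ^ Int.negSucc n = y⁻¹ ^ (n + 1) := fun y => by
      rw [zpow_negSucc, inv_pow]
    refine (convPow_antipode_e (n + 1) a x).trans ?_
    simp only [h, mul_inv_rev, inv_inv]

open Classical in
theorem sweedlerPower_normalizedIntegral_apply (m : ℤ) (b y : G) :
    sweedlerPower m (normalizedIntegral (DrinfeldDouble G)) (b, y) =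
      (Fintype.card G : ℂ)⁻¹ *
        (Nat.card {x : G // x ^ m = y ∧ (b * x⁻¹) ^ m * x ^ m = 1} : ℂ) := by
  rw [normalizedIntegral_eq, map_smul, smul_apply, map_sum, sum_apply]
  congr 1
  have h : ∀ x : G, sweedlerPower m (e (1 : G) x) (b, y) =
      if x ^ m = y ∧ (b * x⁻¹) ^ m * x ^ m = 1 then 1 else 0 := by
    intro x
    rw [sweedlerPower_e, sum_apply, Finset.sum_eq_single b]
    · by_cases h1 : (b * x⁻¹) ^ m * x ^ m = 1
      · simp [h1, e_apply, eq_comm]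
      · simp [h1]
    · intro c _ hc
      split_ifs <;> simp [e_apply, hc.symm]
    · simp
  simp only [h, Finset.sum_boole, Nat.card_eq_fintype_card, Fintype.card_subtype]

/-! ### The trace of the associated module and the indicator -/

section Trace

variable (g : G) {W : Type*} [AddCommGroup W] [Module ℂ W]
  (σ : Representation ℂ (Subgroup.centralizer {g}) W)

theorem trace_moduleOf [Fintype (Subgroup.centralizer {g})] [FiniteDimensional ℂ W]
    (f : DrinfeldDouble G) :
    LinearMap.trace ℂ _ (moduleOf g σ f) = (Fintype.card (Subgroup.centralizer {g}) : ℂ)⁻¹ *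
      ∑ t : G, ∑ c : Subgroup.centralizer {g},
        f (t⁻¹ * g * t, t⁻¹ * c * t) * σ.character c := by
  set ι := (Representation.coindV (Subgroup.centralizer {g}).subtype σ).subtype
  -- Cyclicity of the trace then moves the computation to the full function space G → W, which
  -- splits into blocks indexed by G.
  have h : moduleOf g σ f = coindAverage g σ ∘ₗ (ι ∘ₗ moduleOf g σ f) := by
    rw [← LinearMap.comp_assoc, coindAverage_subtype, LinearMap.id_comp]
  rw [h, LinearMap.trace_comp_comm', LinearMap.trace_pi_eq_sum, Finset.mul_sum]
  refine Finset.sum_congr rfl fun t _ => ?_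
  have key : LinearMap.proj t ∘ₗ ((ι ∘ₗ moduleOf g σ f) ∘ₗ coindAverage g σ) ∘ₗ
      LinearMap.single ℂ (fun _ : G => W) t = (Fintype.card (Subgroup.centralizer {g}) : ℂ)⁻¹ •
        ∑ c : Subgroup.centralizer {g}, f (t⁻¹ * g * t, t⁻¹ * c * t) • σ c := by
    ext w
    have hι : ∀ v, ι v = (v : G → W) := fun _ => rfl
    simp only [LinearMap.comp_apply, LinearMap.proj_apply, hι, moduleOf_apply,
      coindAverage_apply, LinearMap.smul_apply, LinearMap.sum_apply, LinearMap.coe_single]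
    simp only [smul_comm _ ((Fintype.card (Subgroup.centralizer {g}) : ℂ)⁻¹), ← Finset.smul_sum]
    congr 1
    simp only [Finset.smul_sum]
    rw [Finset.sum_comm]
    refine Finset.sum_congr rfl fun c _ => ?_
    -- A function supported at t contributes to the block at t only if c⁻¹ t x = t.
    rw [Finset.sum_eq_single (t⁻¹ * c * t)]
    · have : (c : G)⁻¹ * (t * (t⁻¹ * c * t)) = t := by group
      rw [this, Pi.single_eq_same]
    · intro x _ hx
      have : (c : G)⁻¹ * (t * x) ≠ t := by
        intro h
        exact hx (by rw [inv_mul_eq_iff_eq_mul] at h; rw [mul_assoc, ← h]; group)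
      rw [Pi.single_eq_of_ne this, map_zero, smul_zero]
    · simp
  rw [key]
  simp [Representation.character]

/-- By `card_roots_eq` the summand of the trace does not depend on t, so summing over t cancels the
factor |G|⁻¹ of the integral. -/
theorem fsIndicator_moduleOf [Fintype (Subgroup.centralizer {g})] [FiniteDimensional ℂ W]
    (m : ℤ) :
    fsIndicator (moduleOf g σ) m = 1 / (Fintype.card (Subgroup.centralizer {g}) : ℂ) *
      ∑ z : Subgroup.centralizer {g},
        gammaFun m (z : G) ⟨g, mem_centralizer_symm z.2⟩ * σ.character z := by
  have hG : (Fintype.card G : ℂ) ≠ 0 := Nat.cast_ne_zero.2 Fintype.card_ne_zero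
  rw [fsIndicator, trace_moduleOf, one_div]
  simp only [sweedlerPower_normalizedIntegral_apply, card_roots_eq, Finset.sum_const,
    Finset.card_univ, nsmul_eq_mul, mul_assoc (Fintype.card G : ℂ)⁻¹, ← Finset.mul_sum]
  rw [mul_inv_cancel_left₀ hG]

end Trace

end DrinfeldDouble

/-! ### Sums over conjugacy class representatives -/

/-- The sum of a class function over a finite group, in terms of representatives of the conjugacy
classes. -/
theorem sum_eq_sum_conjClasses_representatives {K : Type*} [Group K] [Fintype K] (f : K → ℂ)
    (hf : ∀ x y, IsConj x y → f x = f y) (R : Finset K)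
    (hR : Set.BijOn ConjClasses.mk (R : Set K) Set.univ) :
    ∑ x, f x = ∑ z ∈ R, (Nat.card (ConjClasses.mk z).carrier : ℂ) * f z := by
  classical
  have hx : ∀ x : K, ∃ z ∈ R, ConjClasses.mk z = ConjClasses.mk x := fun x => by
    obtain ⟨z, hz, h⟩ := hR.surjOn (Set.mem_univ (ConjClasses.mk x))
    exact ⟨z, hz, h⟩
  choose r hr hr' using hx
  rw [← Finset.sum_fiberwise_of_maps_to (s := Finset.univ) (t := R) (g := r) fun x _ => hr x]
  refine Finset.sum_congr rfl fun z hz => ?_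
  have h : ∀ x, r x = z ↔ x ∈ (ConjClasses.mk z).carrier := fun x => by
    rw [ConjClasses.mem_carrier_iff_mk_eq, ← hr' x]
    exact ⟨fun h => h ▸ rfl, fun h => hR.injOn (hr x) hz h⟩
  have h' : ∀ x ∈ Finset.univ.filter (fun x => r x = z), f x = f z := fun x hx => by
    refine hf _ _ (ConjClasses.mk_eq_mk_iff_isConj.1 ?_)
    rw [← hr' x, (Finset.mem_filter.1 hx).2]
  rw [Finset.sum_congr rfl h', Finset.sum_const, nsmul_eq_mul]
  congr 2
  rw [Nat.card_eq_fintype_card, Fintype.card_subtype]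
  simp only [h]

end

/-! ### Complex characters: Maschke, unitarity, Schur -/

noncomputable section

namespace Representation

theorem Equiv.isIrreducible {k K V W : Type*} [Field k] [Monoid K] [AddCommGroup V] [Module k V]
    [AddCommGroup W] [Module k W] {ρ : Representation k K V} {τ : Representation k K W}
    (φ : ρ.Equiv τ) (h : ρ.IsIrreducible) : τ.IsIrreducible := by
  rw [irreducible_iff_isSimpleModule_asModule] at h ⊢
  have hφ : ∀ v, φ.symm.toIntertwiningMap (φ.toIntertwiningMap v) = v := φ.symm_apply_apply
  have hφ' : ∀ v, φ.toIntertwiningMap (φ.symm.toIntertwiningMap v) = v := φ.apply_symm_apply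
  let f := IntertwiningMap.equivLinearMapAsModule ρ τ φ.toIntertwiningMap
  let f' := IntertwiningMap.equivLinearMapAsModule τ ρ φ.symm.toIntertwiningMap
  exact IsSimpleModule.congr (LinearEquiv.ofLinearMap f' f (LinearMap.ext hφ) (LinearMap.ext hφ'))

section Character

variable {K : Type*} [Group K]

/-- `irrChars` allows only the spaces `Fin n → ℂ`; a basis transports any finite-dimensional
representation to one of these. -/
theorem character_mem_irrChars {V : Type*} [AddCommGroup V] [Module ℂ V] [FiniteDimensional ℂ V]
    (ρ : Representation ℂ K V) (h : ρ.IsIrreducible) : ρ.character ∈ irrChars K := by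
  let e := (Module.finBasis ℂ V).equivFun
  let τ : Representation ℂ K (Fin (Module.finrank ℂ V) → ℂ) :=
    { toFun := fun x => e.conj (ρ x)
      map_one' := by ext; simp [LinearEquiv.conj_apply]
      map_mul' := fun x y => by simp [Module.End.mul_eq_comp, LinearEquiv.conj_comp] }
  let φ : ρ.Equiv τ := .mk e fun x => by ext v; simp [τ, LinearEquiv.conj_apply]
  exact ⟨_, τ, φ.isIrreducible h, (char_iso φ).symm⟩

theorem character_eq_add_of_isCompl {V : Type*} [AddCommGroup V] [Module ℂ V]
    [FiniteDimensional ℂ V] (ρ : Representation ℂ K V) {p q : Subrepresentation ρ}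
    (h : IsCompl p.toSubmodule q.toSubmodule) :
    ρ.character = p.toRepresentation.character + q.toRepresentation.character := by
  ext x
  let e := Submodule.prodEquivOfIsCompl _ _ h
  have : ρ x = e.conj ((p.toRepresentation x).prodMap (q.toRepresentation x)) := by
    refine LinearMap.ext fun v => ?_
    obtain ⟨⟨a, b⟩, rfl⟩ := e.surjective v
    simp [e, LinearEquiv.conj_apply, Subrepresentation.toRepresentation]
  rw [character, this, LinearMap.trace_conj', LinearMap.trace_prodMap']
  rfl

/-- Complete reducibility by strong induction on the dimension: a reducible representation splits
into two proper summands and its character adds up. -/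
theorem character_mem_span_irrChars [Finite K] {V : Type*} [AddCommGroup V] [Module ℂ V]
    [FiniteDimensional ℂ V] (ρ : Representation ℂ K V) :
    ρ.character ∈ Submodule.span ℂ (irrChars K) := by
  induction hn : Module.finrank ℂ V using Nat.strong_induction_on generalizing V with
  | _ n ih =>
  subst hn
  by_cases hV : Subsingleton V
  · have : ρ.character = 0 := by
      ext x
      rw [character, Subsingleton.elim (ρ x) 0]
      simp
    rw [this]
    exact zero_mem _
  by_cases h : ρ.IsIrreducible
  · exact Submodule.subset_span (character_mem_irrChars ρ h)
  have hV' : Nontrivial V := not_subsingleton_iff_nontrivial.1 hV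
  have hbt : (⊥ : Subrepresentation ρ) ≠ ⊤ := fun h' =>
    bot_ne_top (α := Submodule ℂ V) (congrArg Subrepresentation.toSubmodule h')
  have : Nontrivial (Subrepresentation ρ) := ⟨⊥, ⊤, hbt⟩
  obtain ⟨p, hp⟩ : ∃ p : Subrepresentation ρ, ¬ (p = ⊥ ∨ p = ⊤) := by
    by_contra! h'
    exact h ⟨h'⟩
  rw [not_or] at hp
  -- Maschke's theorem needs |K| ≠ 0 in ℂ to supply the complement.
  have : NeZero (Nat.card K : ℂ) := ⟨Nat.cast_ne_zero.2 Nat.card_pos.ne'⟩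
  obtain ⟨q, hq⟩ := exists_isCompl p
  have hpq : IsCompl p.toSubmodule q.toSubmodule :=
    IsCompl.of_eq (congrArg Subrepresentation.toSubmodule hq.inf_eq_bot)
      (congrArg Subrepresentation.toSubmodule hq.sup_eq_top)
  have hp' : p.toSubmodule ≠ ⊤ := fun h' => hp.2 (Subrepresentation.toSubmodule_injective h')
  have hq' : q.toSubmodule ≠ ⊤ := fun h' => hp.1 (Subrepresentation.toSubmodule_injective
    (by rw [← inf_top_eq p.toSubmodule, ← h', hpq.inf_eq_bot]; rfl))
  rw [character_eq_add_of_isCompl ρ hpq]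
  exact add_mem (ih _ (Submodule.finrank_lt hp') _ rfl)
    (ih _ (Submodule.finrank_lt hq') _ rfl)

/-- The value of a complex character at an inverse, by averaging a Hermitian form. -/
theorem character_inv [Fintype K] {n : ℕ} (ρ : Representation ℂ K (Fin n → ℂ)) (y : K) :
    ρ.character y⁻¹ = (starRingEnd ℂ) (ρ.character y) := by
  open scoped Matrix ComplexOrder in
  classical
  let A : K → Matrix (Fin n) (Fin n) ℂ := fun x => LinearMap.toMatrix' (ρ x)
  have hA : ∀ x y, A (x * y) = A x * A y := fun x y => by
    simp [A, Module.End.mul_eq_comp, LinearMap.toMatrix'_comp]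
  have hA1 : A 1 = 1 := by simp [A, Module.End.one_eq_id]
  have hχ : ∀ x, ρ.character x = (A x).trace := fun x => by
    rw [character, ← Matrix.trace_toLin'_eq, Matrix.toLin'_toMatrix']
  let M : Matrix (Fin n) (Fin n) ℂ := ∑ x, (A x)ᴴ * A x
  have hM : M.PosDef := by
    -- The term at the identity is the identity matrix, which makes the semidefinite sum definite
    -- and hence invertible.
    have h1 : M = ∑ x ∈ Finset.univ.erase 1, (A x)ᴴ * A x + 1 := by
      have h := Finset.sum_erase_add Finset.univ (fun x => (A x)ᴴ * A x) (Finset.mem_univ (1 : K))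
      rw [hA1, Matrix.conjTranspose_one, mul_one] at h
      exact h.symm
    rw [h1]
    exact Matrix.PosDef.posSemidef_add
      (Matrix.posSemidef_sum _ fun x _ => Matrix.posSemidef_conjTranspose_mul_self _)
      Matrix.PosDef.one
  have hMu : IsUnit M.det := (Matrix.isUnit_iff_isUnit_det _).1 hM.isUnit
  have h2 : (A y)ᴴ * M * A y = M := by
    simp only [M, Finset.mul_sum, Finset.sum_mul]
    refine Fintype.sum_equiv (Equiv.mulRight y) _ _ fun x => ?_
    simp only [Equiv.coe_mulRight, hA, Matrix.conjTranspose_mul, mul_assoc]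
  -- Invariance of the form makes A(y⁻¹) similar to the adjoint of A(y), so their traces agree.
  have h3 : M * A y⁻¹ = (A y)ᴴ * M := by
    conv_lhs => rw [← h2]
    rw [mul_assoc, ← hA, mul_inv_cancel, hA1, mul_one]
  have h4 : A y⁻¹ = M⁻¹ * ((A y)ᴴ * M) := by
    rw [← h3, Matrix.nonsing_inv_mul_cancel_left _ _ hMu]
  rw [hχ, hχ, h4, Matrix.trace_mul_comm, mul_assoc, Matrix.mul_nonsing_inv _ hMu, mul_one,
    Matrix.trace_conjTranspose]
  rfl

theorem exists_smul_one_of_commute {V : Type*} [AddCommGroup V] [Module ℂ V]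
    [FiniteDimensional ℂ V] (ρ : Representation ℂ K V) (h : ρ.IsIrreducible)
    (T : Module.End ℂ V) (hT : ∀ x, T * ρ x = ρ x * T) : ∃ c : ℂ, T = c • 1 := by
  let f : IntertwiningMap ρ ρ := ⟨T, fun x => hT x⟩
  obtain ⟨c, hc⟩ :=
    (IsIrreducible.algebraMap_intertwiningMap_bijective_of_isAlgClosed (ρ := ρ)).2 f
  exact ⟨c, LinearMap.ext fun v => (congrArg (fun F : IntertwiningMap ρ ρ => F v) hc).symm⟩

/-- Weighting by a class function gives an operator commuting with every ρ(y), so Schur's lemma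
applies. -/
theorem exists_sum_smul_eq_smul_one [Fintype K] {V : Type*} [AddCommGroup V] [Module ℂ V]
    [FiniteDimensional ℂ V] (ρ : Representation ℂ K V) (h : ρ.IsIrreducible) (w : K → ℂ)
    (hw : ∀ x y, w (y * x * y⁻¹) = w x) : ∃ c : ℂ, ∑ x, w x • ρ x = c • 1 := by
  refine exists_smul_one_of_commute ρ h _ fun y => ?_
  rw [Finset.sum_mul, Finset.mul_sum]
  refine Fintype.sum_equiv (MulAut.conj y⁻¹).toEquiv _ _ fun x => ?_
  have h1 : (MulAut.conj y⁻¹).toEquiv x = y⁻¹ * x * y⁻¹⁻¹ := rfl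
  rw [h1, hw, smul_mul_assoc, mul_smul_comm, ← map_mul, ← map_mul]
  congr 2
  group

end Character

end Representation

open Representation

/-! ### Orthogonality, the regular character and correlations -/

section Irr

variable {K : Type*} [Group K] [Fintype K]

theorem mem_Irr_iff {χ : K → ℂ} : χ ∈ Irr K ↔ χ ∈ irrChars K := by
  simp [Irr]

theorem irrChars_orthonormal [DecidableEq (K → ℂ)] {χ ψ : K → ℂ} (hχ : χ ∈ irrChars K)
    (hψ : ψ ∈ irrChars K) :
    (Nat.card K : ℂ)⁻¹ * ∑ x : K, χ x * ψ x⁻¹ = if χ = ψ then 1 else 0 := by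
  classical
  obtain ⟨n, ρ, hρ, rfl⟩ := hχ
  obtain ⟨k, τ, hτ, rfl⟩ := hψ
  let _ : Invertible (Nat.card K : ℂ) :=
    invertibleOfNonzero (Nat.cast_ne_zero.2 Nat.card_pos.ne')
  have h := char_orthonormal ρ τ
  by_cases hne : Nonempty (Representation.Equiv τ ρ)
  · rw [h, if_pos hne, if_pos (char_iso hne.some).symm]
  · rw [if_neg hne] at h
    rw [h, if_neg]
    intro heq
    have h' := char_orthonormal ρ ρ
    rw [if_pos ⟨Representation.Equiv.refl ρ⟩, heq, ← heq] at h'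
    rw [← heq, h'] at h
    exact one_ne_zero h

/-- Left translation of functions on a group. -/
def leftTranslation (K : Type*) [Group K] : Representation ℂ K (K → ℂ) where
  toFun x := LinearMap.funLeft ℂ ℂ (x⁻¹ * ·)
  map_one' := by ext; simp
  map_mul' x y := by ext; simp [LinearMap.funLeft_apply, mul_assoc]

theorem leftTranslation_character [DecidableEq K] (x : K) :
    (leftTranslation K).character x = if x = 1 then (Fintype.card K : ℂ) else 0 := by
  rw [character, LinearMap.trace_pi_eq_sum]
  have h : ∀ y : K, LinearMap.proj y ∘ₗ leftTranslation K x ∘ₗ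
      LinearMap.single ℂ (fun _ : K => ℂ) y = if x = 1 then 1 else 0 := fun y => by
    ext
    by_cases hx : x = 1
    · simp [hx]
    · have : x⁻¹ * y ≠ y := by simpa using hx
      simp [hx, leftTranslation, LinearMap.funLeft_apply, this]
  simp only [h]
  split_ifs <;> simp

/-- The decomposition of the regular character. -/
theorem sum_Irr_apply_one_mul [DecidableEq K] (x : K) :
    ∑ χ ∈ Irr K, χ 1 * χ x = if x = 1 then (Fintype.card K : ℂ) else 0 := by
  classical
  have hK : (Nat.card K : ℂ) ≠ 0 := Nat.cast_ne_zero.2 Nat.card_pos.ne'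
  have hmem := character_mem_span_irrChars (leftTranslation K)
  have hI : irrChars K = (Irr K : Set (K → ℂ)) := by ext; simp [mem_Irr_iff]
  rw [hI, Submodule.mem_span_finset] at hmem
  obtain ⟨c, -, hc⟩ := hmem
  have hc' : ∀ y, ∑ χ ∈ Irr K, c χ * χ y = if y = 1 then (Fintype.card K : ℂ) else 0 := fun y => by
    rw [← leftTranslation_character, ← hc]
    simp
  rw [← hc']
  refine Finset.sum_congr rfl fun ψ hψ => ?_
  congr 1
  -- Pairing the regular character with ψ picks out its value at the identity, while orthonormality
  -- picks out the coefficient of ψ.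
  have h1 : (Nat.card K : ℂ)⁻¹ * ∑ y : K, (∑ χ ∈ Irr K, c χ * χ y) * ψ y⁻¹ = ψ 1 := by
    simp [hc', Nat.card_eq_fintype_card]
  rw [← h1]
  simp only [Finset.sum_mul, mul_assoc]
  rw [Finset.sum_comm, Finset.mul_sum, Finset.sum_eq_single ψ]
  · rw [← Finset.mul_sum, mul_left_comm,
      irrChars_orthonormal (mem_Irr_iff.1 hψ) (mem_Irr_iff.1 hψ), if_pos rfl, mul_one]
  · intro χ hχ hne
    rw [← Finset.mul_sum, mul_left_comm,
      irrChars_orthonormal (mem_Irr_iff.1 hχ) (mem_Irr_iff.1 hψ), if_neg hne, mul_zero]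
  · exact fun h => absurd hψ h

/-- The double sum is the trace of ρ(g) times the two Schur scalars α and β, that is, αβ χ(g). The
multiples αχ(1) and βχ(1) are |K|⟨χ, w⟩ and its conjugate, by reality of w and χ(y⁻¹) = conj χ(y).
-/
theorem sum_sum_mul_irrChars {χ : K → ℂ} (hχ : χ ∈ irrChars K) (w : K → ℂ)
    (hw : ∀ x y, w (y * x * y⁻¹) = w x) (hreal : ∀ x, (starRingEnd ℂ) (w x) = w x) (g : K) :
    χ 1 * ∑ x, ∑ y, w x * w y * χ (g * x * y⁻¹) =
      (Fintype.card K : ℂ) ^ 2 * ((((‖charInner χ w‖ ^ 2 : ℝ) : ℂ) / χ 1) * χ g) := by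
  obtain ⟨n, ρ, hρ, rfl⟩ := hχ
  have hK : (Fintype.card K : ℂ) ≠ 0 := Nat.cast_ne_zero.2 Fintype.card_ne_zero
  have hd : ρ.character 1 ≠ 0 := by
    rw [char_one, Nat.cast_ne_zero]
    intro h0
    have : Subsingleton (Fin n → ℂ) := Module.finrank_zero_iff.1 h0
    have hbt := bot_ne_top (α := Subrepresentation ρ)
    exact hbt (Subrepresentation.toSubmodule_injective (Subsingleton.elim _ _))
  obtain ⟨α, hα⟩ := exists_sum_smul_eq_smul_one ρ hρ w hw
  obtain ⟨β, hβ⟩ := exists_sum_smul_eq_smul_one ρ hρ (fun x => w x⁻¹) fun x y => by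
    rw [← hw x⁻¹ y]; congr 1; group
  have hβ' : ∑ x, w x • ρ x⁻¹ = β • (1 : Module.End ℂ (Fin n → ℂ)) := by
    rw [← hβ]
    exact Fintype.sum_equiv (Equiv.inv K) _ _ fun x => by simp
  have hα1 : ∑ x, w x * ρ.character x = α * ρ.character 1 := by
    simpa [character] using congrArg (LinearMap.trace ℂ _) hα
  have hβ1 : ∑ x, w x * ρ.character x⁻¹ = β * ρ.character 1 := by
    simpa [character] using congrArg (LinearMap.trace ℂ _) hβ'
  have hinner : charInner ρ.character w =
      (Fintype.card K : ℂ)⁻¹ * (α * ρ.character 1) := by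
    rw [charInner, ← hα1]
    simp only [hreal, mul_comm]
  have hinner' : (starRingEnd ℂ) (charInner ρ.character w) =
      (Fintype.card K : ℂ)⁻¹ * (β * ρ.character 1) := by
    rw [charInner, ← hβ1]
    simp [character_inv, mul_comm]
  have hnorm : ((‖charInner ρ.character w‖ ^ 2 : ℝ) : ℂ) =
      (Fintype.card K : ℂ)⁻¹ * (α * ρ.character 1) *
        ((Fintype.card K : ℂ)⁻¹ * (β * ρ.character 1)) := by
    rw [← hinner', ← hinner, Complex.mul_conj, Complex.normSq_eq_norm_sq]
  have hsum : ∑ x, ∑ y, w x * w y * ρ.character (g * x * y⁻¹) = α * β * ρ.character g := by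
    have h1 : ρ g * (∑ x, w x • ρ x) * (∑ y, w y • ρ y⁻¹) = (α * β) • ρ g := by
      rw [hα, hβ']
      simp [smul_smul, mul_comm]
    have h2 := congrArg (LinearMap.trace ℂ _) h1
    simp only [Finset.mul_sum, Finset.sum_mul, map_sum, mul_smul_comm, smul_mul_assoc, map_smul,
      ← map_mul ρ, smul_eq_mul] at h2
    rw [Finset.sum_comm] at h2
    simpa only [character, mul_left_comm, mul_assoc] using h2
  rw [hsum, hnorm]
  field_simp

/-- The correlation of a real class function with itself, in terms of irreducible characters. -/
theorem sum_mul_translate_eq (w : K → ℂ) (hw : ∀ x y, w (y * x * y⁻¹) = w x)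
    (hreal : ∀ x, (starRingEnd ℂ) (w x) = w x) (g : K) :
    ∑ x, w x * w (g * x) = (Fintype.card K : ℂ) *
      ∑ χ ∈ Irr K, (((‖charInner χ w‖ ^ 2 : ℝ) : ℂ) / χ 1) * χ g := by
  classical
  have hK : (Fintype.card K : ℂ) ≠ 0 := Nat.cast_ne_zero.2 Fintype.card_ne_zero
  -- The regular character at g x y⁻¹ acts as |K| times the indicator of y = gx.
  have h1 : (Fintype.card K : ℂ) * ∑ x, w x * w (g * x) =
      ∑ x, ∑ y, w x * w y * ∑ χ ∈ Irr K, χ 1 * χ (g * x * y⁻¹) := by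
    simp only [sum_Irr_apply_one_mul, mul_inv_eq_one, mul_ite, mul_zero,
      Finset.sum_ite_eq, Finset.mem_univ, if_true, Finset.mul_sum]
    exact Finset.sum_congr rfl fun x _ => mul_comm _ _
  have h2 : ∑ x, ∑ y, w x * w y * ∑ χ ∈ Irr K, χ 1 * χ (g * x * y⁻¹) =
      ∑ χ ∈ Irr K, χ 1 * ∑ x, ∑ y, w x * w y * χ (g * x * y⁻¹) := by
    simp only [Finset.mul_sum]
    rw [Finset.sum_congr rfl fun x _ => Finset.sum_comm, Finset.sum_comm]
    refine Finset.sum_congr rfl fun χ _ => Finset.sum_congr rfl fun x _ =>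
      Finset.sum_congr rfl fun y _ => mul_left_comm _ _ _
  refine mul_left_cancel₀ hK ?_
  rw [h1, h2, Finset.sum_congr rfl fun χ hχ =>
    sum_sum_mul_irrChars (mem_Irr_iff.1 hχ) w hw hreal g, ← Finset.mul_sum]
  ring

end Irr

/-! ### The character expansion of γ -/

open Classical in
theorem gammaFun_apply_eq_sum {G : Type*} [Group G] [Fintype G] (m : ℤ) (z : G)
    (g : Subgroup.centralizer {z}) :
    gammaFun m z g = ∑ x, rootIndicator m z x * rootIndicator m z (g * x) := by
  have h : ∀ x : Subgroup.centralizer {z}, rootIndicator m z x * rootIndicator m z (g * x) =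
      if (x : G) ^ m = z ∧ ((g : G) * x) ^ m = z then 1 else 0 := fun x => by
    simp only [rootIndicator, Subgroup.coe_mul, ite_and]
    split_ifs <;> simp
  simp only [h, Finset.sum_boole, gammaFun]
  rw [← Fintype.card_subtype, ← Nat.card_eq_fintype_card]
  congr 1
  -- An element commutes with its own m-th power z, so counting in G or in the centralizer of z
  -- gives the same number.
  refine Nat.card_congr ⟨fun x => ⟨⟨x, ?_⟩, x.2⟩, fun x => ⟨x, x.2⟩, fun _ => rfl, fun _ => rfl⟩
  rw [Subgroup.mem_centralizer_singleton_iff]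
  have hcomm : Commute (x : G) ((x : G) ^ m) := (Commute.refl (x : G)).zpow_right m
  rw [x.2.1] at hcomm
  exact hcomm

open Classical in
theorem gammaFun_eq_sum_Irr {G : Type*} [Group G] [Fintype G] (m : ℤ) (z : G) :
    gammaFun m z = (Fintype.card (Subgroup.centralizer {z}) : ℂ) •
      ∑ χ ∈ Irr (Subgroup.centralizer {z}),
        (((‖charInner χ (rootIndicator m z)‖ ^ 2 : ℝ) : ℂ) / χ 1) • χ := by
  ext g
  rw [gammaFun_apply_eq_sum, sum_mul_translate_eq]
  · simp
  -- The root indicator is a class function because conjugation by y in the centralizer fixes z.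
  · intro x y
    have hy : (y : G) * z * (y : G)⁻¹ = z := by
      rw [Subgroup.mem_centralizer_singleton_iff.1 y.2, mul_inv_cancel_right]
    have : (y : G) * (x : G) ^ m * (y : G)⁻¹ = z ↔ (x : G) ^ m = z :=
      ⟨fun h => mul_left_cancel (mul_right_cancel (h.trans hy.symm)), fun h => by rw [h, hy]⟩
    simp [rootIndicator, conj_zpow, this]
  · intro x
    unfold rootIndicator
    split_ifs <;> simp

end

/-! ### The main theorem -/

open scoped Classical in
theorem mainTheorem1 {G : Type*} [Group G] [Fintype G] (m : ℤ) :
    (∀ (g : G) {W : Type*} [AddCommGroup W] [Module ℂ W] [FiniteDimensional ℂ W]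
      (σ : Representation ℂ (Subgroup.centralizer {g}) W),
      fsIndicator (DrinfeldDouble.moduleOf g σ) m =
        1 / (Fintype.card (Subgroup.centralizer {g}) : ℂ) *
          ∑ z : Subgroup.centralizer {g},
            gammaFun m (z : G) ⟨g, mem_centralizer_symm z.2⟩ * σ.character z ∧
      ∀ R : Finset (Subgroup.centralizer {g}),
        Set.BijOn ConjClasses.mk (R : Set (Subgroup.centralizer {g})) Set.univ →
        fsIndicator (DrinfeldDouble.moduleOf g σ) m =
          1 / (Fintype.card (Subgroup.centralizer {g}) : ℂ) *
            ∑ z ∈ R, (Nat.card (ConjClasses.mk z).carrier : ℂ) *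
              gammaFun m (z : G) ⟨g, mem_centralizer_symm z.2⟩ * σ.character z) ∧
    ∀ z : G, gammaFun m z =
      (Fintype.card (Subgroup.centralizer {z}) : ℂ) •
        ∑ χ ∈ Irr (Subgroup.centralizer {z}),
          (((‖charInner χ (rootIndicator m z)‖ ^ 2 : ℝ) : ℂ) / χ 1) • χ := by
  refine ⟨fun g W _ _ _ σ => ⟨DrinfeldDouble.fsIndicator_moduleOf g σ m, fun R hR => ?_⟩,
    gammaFun_eq_sum_Irr m⟩
  rw [DrinfeldDouble.fsIndicator_moduleOf, sum_eq_sum_conjClasses_representatives _ ?_ R hR]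
  · simp only [mul_assoc]
  · intro x y hxy
    obtain ⟨c, hc⟩ := isConj_iff.1 hxy
    rw [← hc, Representation.char_conj]
    congr 1
    exact gammaFun_conj m _ _ c c.2 (by simp)
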